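/- Let $k\ge 1$ and let $\Lambda$ be a row-finite, locally convex $k$-graph. That is, $\Lambda$ is a countable category with a functor $d:\Lambda\to\mathbb N^k$ such that whenever $d(\lambda)=m+n$ there is a unique factorisation $\lambda=\mu\nu$ with $d(\mu)=m$, $d(\nu)=n$. We identify $\Lambda$ with its set of arrows (paths) and its objects (vertices) with the identity arrows $\Lambda^0$; $r,s$ are the range and source maps, $r(\mu\nu)=r(\mu)$, $s(\mu\nu)=s(\nu)$, and $v\Lambda^m=\{\lambda: r(\lambda)=v,\ d(\lambda)=m\}$. Row-finite means that $\bigcup_i v\Lambda^{e_i}$ is finite for every vertex $v$; locally convex means that for $i<j$, $\mu\in v\Lambda^{e_i}$ and $\nu\in v\Lambda^{e_j}$ the sets $s(\mu)\Lambda^{e_j}$ and $s(\nu)\Lambda^{e_i}$ are nonempty. Let $v\Lambda^{\le m}$ be the set of paths $\lambda$ with range $v$ such that either $d(\lambda)=m$, or $d(\lambda)<m$ and no proper extension $\lambda\nu$ of $\lambda$ satisfies $d(\lambda\nu)\le m$. Let $\mathcal P_\Lambda$ be the universal C$^*$-algebra generated by $\{a_\lambda:\lambda\in\Lambda\}$ subject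 to: the $a_v$ ($v\in\Lambda^0$) are mutually orthogonal projections; $\sum_{\lambda\in v\Lambda^{\le m}}a_\lambda^*a_\lambda=a_v$ for all $v\in\Lambda^0$, $m\in\mathbb N^k$; and $a_\mu a_\nu=a_{\nu\mu}$ whenever $\nu\mu$ is defined. Let $\mathcal A_\Lambda=\overline{\operatorname{span}}\{a_\lambda:\lambda\in\Lambda\}\subset\mathcal P_\Lambda$. An $\mathcal A_\Lambda$-module is a complex Hilbert space $H$ with a continuous algebra homomorphism $\pi:\mathcal A_\Lambda\to B(H)$ such that, writing $A_\lambda=\pi(a_\lambda)$, each $A_v$ ($v\in\Lambda^0$) is an orthogonal projection, $\sum_{\lambda\in v\Lambda^{e_j}}A_\lambda^*A_\lambda=A_v$ whenever $v\Lambda^{e_j}\ne\emptyset$, and the finite partial sums of $\sum_{v}A_v$ converge to $1_H$ in the weak operator topology. A submodule of $H$ is a closed subspace invariant under $\pi(\mathcal A_\Lambda)$. Put $H_v=A_vH$. The trees at $v\in\Lambda^0$ are the finite sets of paths defined inductively as follows: $\{v\}$ is a tree at $v$; and if $t$ is a tree at $v$, $\mu\in t$ and $1\le i\le k$, then $(t\setminus\{\mu\})\cup\{\mu\nu:\nu\in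 \vee_{s(\mu),i}\}$ is a tree at $v$, where $\vee_{w,i}=w\Lambda^{e_i}$ if this set is nonempty and $\vee_{w,i}=\{w\}$ otherwise. A submodule $H'$ of $H$ is weakly complete if its orthogonal complement in $H$ contains no nonzero submodule of $H$. It is complete if for all $\varepsilon>0$, $v\in\Lambda^0$ and $\xi\in H_v$ there are a tree $t$ at $v$ and vectors $(\eta_\mu)_{\mu\in t}$ in $H'$ with $\sum_{\mu\in t}\|A_\mu\xi-\eta_\mu\|^2<\varepsilon^2$. Proposition. Let $H$ be a finite-dimensional $\mathcal A_\Lambda$-module. Then a submodule $H'\subset H$ is weakly complete if and only if it is complete. -/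

import Mathlib

open CategoryTheory
open scoped ENNReal InnerProductSpace

/-- A path of a category: an arrow together with its source and its range. -/
structure GPath (V : Type*) [Category V] where
  src : V
  rng : V
  hom : src ⟶ rng

/-- A `k`-graph: a countable category `V` with a degree functor `deg` to the monoid `ℕ^k`
satisfying the factorisation property. The vertices are the objects of `V`; the path `μ ∘ ν`
("first `ν`, then `μ`", with range `r(μ)` and source `s(ν)`) is written `ν ≫ μ`. -/
structure KGraph (k : ℕ) (V : Type*) [Category V] where
  countable_obj : Countable V
  countable_hom : ∀ u v : V, Countable (u ⟶ v)
  deg : ∀ {u v : V}, (u ⟶ v) → (Fin k → ℕ)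
  deg_id : ∀ v : V, deg (𝟙 v) = 0
  deg_comp : ∀ {u v w : V} (ν : u ⟶ v) (μ : v ⟶ w), deg (ν ≫ μ) = deg μ + deg ν
  factorisation : ∀ {u v : V} (f : u ⟶ v) (m n : Fin k → ℕ), deg f = m + n →
    ∃! p : Σ w : V, (u ⟶ w) × (w ⟶ v), p.2.1 ≫ p.2.2 = f ∧ deg p.2.2 = m ∧ deg p.2.1 = n

namespace KGraph

variable {k : ℕ} {V : Type*} [Category V] (Λ : KGraph k V)

/-- The degree of a path. -/
def d (p : GPath V) : Fin k → ℕ := Λ.deg p.hom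

/-- The vertex `v` seen as a path (the identity arrow). -/
def vtx (_ : KGraph k V) (v : V) : GPath V := ⟨v, v, 𝟙 v⟩

/-- The set `vΛ^m` of paths of degree `m` with range `v`. -/
def pathsOfDegree (v : V) (m : Fin k → ℕ) : Set (GPath V) := {p | p.rng = v ∧ Λ.d p = m}

/-- The set `vΛ^{e_i}` of edges of colour `i` with range `v`. -/
def edges (v : V) (i : Fin k) : Set (GPath V) := Λ.pathsOfDegree v (Pi.single i 1)

/-- The set `vΛ^{≤ m}` of paths with range `v` that have degree `m`, or degree `< m` and no
proper extension `p ∘ ν` of degree `≤ m`. -/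
def pathsLE (v : V) (m : Fin k → ℕ) : Set (GPath V) :=
  {p | p.rng = v ∧ (Λ.d p = m ∨
    (Λ.d p < m ∧ ∀ (u : V) (ν : u ⟶ p.src), Λ.deg ν ≠ 0 → ¬ Λ.deg (ν ≫ p.hom) ≤ m))}

/-- Row-finiteness: every vertex is the range of finitely many edges. -/
class RowFinite : Prop where
  finite : ∀ v : V, (⋃ i : Fin k, Λ.edges v i).Finite

/-- Local convexity. -/
class LocallyConvex : Prop where
  convex : ∀ (i j : Fin k), i < j → ∀ (v : V), ∀ μ ∈ Λ.edges v i, ∀ ν ∈ Λ.edges v j,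
    (Λ.edges μ.src j).Nonempty ∧ (Λ.edges ν.src i).Nonempty

theorem edges_finite [Λ.RowFinite] (v : V) (i : Fin k) : (Λ.edges v i).Finite :=
  (RowFinite.finite (Λ := Λ) v).subset (Set.subset_iUnion _ i)

theorem pathsOfDegree_finite [Λ.RowFinite] (N : ℕ) :
    ∀ (v : V) (m : Fin k → ℕ), ∑ i, m i = N → (Λ.pathsOfDegree v m).Finite := by
  induction N with
  | zero =>
    intro v m hm
    have hm0 : m = 0 := by
      funext i
      simpa using (Finset.sum_eq_zero_iff.1 hm) i (Finset.mem_univ i)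
    subst hm0
    refine (Set.finite_singleton (Λ.vtx v)).subset ?_
    rintro ⟨u, w, f⟩ ⟨hr, hd⟩
    simp only at hr
    subst hr
    have hd' : Λ.deg f = 0 := hd
    obtain ⟨p, -, hp⟩ := Λ.factorisation f 0 0 (by simp [hd'])
    have h1 := hp ⟨u, 𝟙 u, f⟩ ⟨by simp, hd', Λ.deg_id u⟩
    have h2 := hp ⟨w, f, 𝟙 w⟩ ⟨by simp, Λ.deg_id w, hd'⟩
    have h3 := h1.trans h2.symm
    rw [Sigma.mk.injEq] at h3
    obtain ⟨rfl, h3⟩ := h3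
    have h4 := congrArg Prod.fst (eq_of_heq h3)
    simp only at h4
    subst h4
    rfl
  | succ N ih =>
    intro v m hm
    have hne : ∃ i, m i ≠ 0 := by
      by_contra! h
      simp [h] at hm
    obtain ⟨i, hi⟩ := hne
    set n : Fin k → ℕ := m - Pi.single i 1 with hn
    have hmn : m = Pi.single i 1 + n := by
      funext j
      by_cases hj : j = i
      · subst hj; simp [hn]; omega
      · simp [hn, hj]
    have hsum : ∑ j, n j = N := by
      have : ∑ j, m j = 1 + ∑ j, n j := by
        conv_lhs => rw [hmn]
        simp [Finset.sum_add_distrib]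
      omega
    have hfin : (⋃ e ∈ Λ.edges v i, ⋃ q ∈ Λ.pathsOfDegree e.src n,
        {p : GPath V | ∃ h : q.rng = e.src, p = ⟨q.src, e.rng, q.hom ≫ eqToHom h ≫ e.hom⟩}).Finite := by
      refine (Λ.edges_finite v i).biUnion fun e _ => (ih e.src n hsum).biUnion fun q _ => ?_
      refine Set.Subsingleton.finite ?_
      rintro p ⟨h, rfl⟩ p' ⟨h', rfl⟩
      rfl
    refine hfin.subset ?_
    rintro ⟨u, w, f⟩ ⟨hr, hd⟩
    have hd' : Λ.deg f = Pi.single i 1 + n := by rw [← hmn]; exact hd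
    obtain ⟨⟨x, a, b⟩, ⟨hab, hb, ha⟩, -⟩ := Λ.factorisation f _ _ hd'
    simp only [Set.mem_iUnion]
    refine ⟨⟨x, w, b⟩, ⟨hr, hb⟩, ⟨u, x, a⟩, ⟨rfl, ha⟩, rfl, ?_⟩
    simp only at hab
    simp [hab]

theorem pathsLE_finite [Λ.RowFinite] (v : V) (m : Fin k → ℕ) : (Λ.pathsLE v m).Finite := by
  refine ((Set.finite_Iic m).biUnion
    fun n _ => Λ.pathsOfDegree_finite _ v n rfl).subset ?_
  rintro p ⟨hr, hp⟩
  simp only [Set.mem_iUnion]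
  refine ⟨Λ.d p, ?_, hr, rfl⟩
  rcases hp with h | h
  · exact h.le
  · exact h.1.le

/-! ### The Pythagorean C*-algebra -/

/-- The defining relations of the Pythagorean algebra for a family `(a_λ)` in a `*`-ring:
the `a_v` are mutually orthogonal projections, `∑_{λ ∈ vΛ^{≤ m}} a_λ^* a_λ = a_v`, and
`a_μ a_ν = a_{ν ∘ μ}` for composable paths. -/
structure IsPythagorean [Λ.RowFinite] {B : Type*} [NonUnitalRing B] [StarRing B]
    (a : GPath V → B) : Prop where
  proj : ∀ v : V, IsStarProjection (a (Λ.vtx v))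
  orth : ∀ v w : V, v ≠ w → a (Λ.vtx v) * a (Λ.vtx w) = 0
  sum : ∀ (v : V) (m : Fin k → ℕ),
    ∑ p ∈ (Λ.pathsLE_finite v m).toFinset, star (a p) * a p = a (Λ.vtx v)
  comp : ∀ {u v w : V} (μ : u ⟶ v) (ν : v ⟶ w),
    a ⟨u, v, μ⟩ * a ⟨v, w, ν⟩ = a ⟨u, w, μ ≫ ν⟩

/-- A representation of the Pythagorean relations by bounded operators on a Hilbert space. -/
structure PRep.{u, w₁, w₂} {k : ℕ} {V : Type w₁} [Category.{w₂} V] (Λ : KGraph k V)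
    [Λ.RowFinite] : Type (max (u + 1) w₁ w₂) where
  carrier : Type u
  [normedAddCommGroup : NormedAddCommGroup carrier]
  [innerProductSpace : InnerProductSpace ℂ carrier]
  [completeSpace : CompleteSpace carrier]
  op : GPath V → carrier →L[ℂ] carrier
  isPythagorean : Λ.IsPythagorean op

attribute [instance] PRep.normedAddCommGroup PRep.innerProductSpace PRep.completeSpace

theorem IsPythagorean.norm_le_one [Λ.RowFinite] {H : Type*} [NormedAddCommGroup H]
    [InnerProductSpace ℂ H] [CompleteSpace H] {A : GPath V → H →L[ℂ] H}
    (hA : Λ.IsPythagorean A) (p : GPath V) : ‖A p‖ ≤ 1 := by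
  have key : ∀ (T : H →L[ℂ] H) (x : H), RCLike.re ⟪(star T * T) x, x⟫_ℂ = ‖T x‖ ^ 2 := by
    intro T x
    rw [ContinuousLinearMap.star_eq_adjoint]
    exact (T.apply_norm_sq_eq_inner_adjoint_left x).symm
  refine ContinuousLinearMap.opNorm_le_bound _ zero_le_one fun x => ?_
  have hv : ‖A (Λ.vtx p.rng) x‖ ≤ ‖x‖ := by
    have h := (hA.proj p.rng).norm_le
    simpa using (A (Λ.vtx p.rng)).le_of_opNorm_le h x
  have hsq : ‖A p x‖ ^ 2 ≤ ‖A (Λ.vtx p.rng) x‖ ^ 2 := by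
    have hproj : star (A (Λ.vtx p.rng)) * A (Λ.vtx p.rng) = A (Λ.vtx p.rng) := by
      rw [(hA.proj p.rng).isSelfAdjoint.star_eq]
      exact (hA.proj p.rng).isIdempotentElem
    rw [← key (A (Λ.vtx p.rng)), hproj, ← hA.sum p.rng (Λ.d p)]
    rw [_root_.sum_apply, sum_inner, map_sum]
    simp only [key]
    refine Finset.single_le_sum (f := fun q => ‖A q x‖ ^ 2) (fun q _ => sq_nonneg _) ?_
    simp [pathsLE]
  calc ‖A p x‖ ≤ ‖A (Λ.vtx p.rng) x‖ := le_of_sq_le_sq hsq (norm_nonneg _)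
    _ ≤ 1 * ‖x‖ := by simpa using hv

/-- The C*-algebra of bounded families of operators, one for each Hilbert-space representation
of the Pythagorean relations. -/
def RepProduct.{u, w₁, w₂} {k : ℕ} {V : Type w₁} [Category.{w₂} V] (Λ : KGraph k V)
    [Λ.RowFinite] : Type (max (u + 1) w₁ w₂) :=
  lp (fun ρ : PRep.{u} Λ => ρ.carrier →L[ℂ] ρ.carrier) ∞

noncomputable instance RepProduct.instNonUnitalCStarAlgebra.{u, w₁, w₂} {k : ℕ} {V : Type w₁}
    [Category.{w₂} V] (Λ : KGraph k V) [Λ.RowFinite] :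
    NonUnitalCStarAlgebra (RepProduct.{u} Λ) :=
  inferInstanceAs (NonUnitalCStarAlgebra
    (lp (fun ρ : PRep.{u} Λ => ρ.carrier →L[ℂ] ρ.carrier) ∞))

/-- The family of all images of the generator indexed by the path `p`. -/
noncomputable def repGen.{u, w₁, w₂} {k : ℕ} {V : Type w₁} [Category.{w₂} V] (Λ : KGraph k V)
    [Λ.RowFinite] (p : GPath V) : RepProduct.{u} Λ :=
  (⟨fun ρ => ρ.op p, memℓp_infty ⟨1, by
    rintro _ ⟨ρ, rfl⟩
    exact ρ.isPythagorean.norm_le_one Λ p⟩⟩ :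
    lp (fun ρ : PRep.{u} Λ => ρ.carrier →L[ℂ] ρ.carrier) ∞)

/-- Evaluation at a representation. -/
noncomputable def repEval.{u, w₁, w₂} {k : ℕ} {V : Type w₁} [Category.{w₂} V] (Λ : KGraph k V)
    [Λ.RowFinite] (ρ : PRep.{u} Λ) :
    RepProduct.{u} Λ →⋆ₙₐ[ℂ] (ρ.carrier →L[ℂ] ρ.carrier) where
  toFun x := x.1 ρ
  map_smul' _ _ := rfl
  map_zero' := rfl
  map_add' _ _ := rfl
  map_mul' _ _ := rfl
  map_star' _ := rfl

theorem repProduct_ext.{u, w₁, w₂} {k : ℕ} {V : Type w₁} [Category.{w₂} V] (Λ : KGraph k V)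
    [Λ.RowFinite] {x y : RepProduct.{u} Λ} (h : ∀ ρ, repEval Λ ρ x = repEval Λ ρ y) : x = y :=
  Subtype.ext (funext h)

theorem isPythagorean_repGen.{u, w₁, w₂} {k : ℕ} {V : Type w₁} [Category.{w₂} V]
    (Λ : KGraph k V) [Λ.RowFinite] : Λ.IsPythagorean (repGen.{u} Λ) where
  proj v := by
    refine ⟨repProduct_ext Λ fun ρ => ?_, repProduct_ext Λ fun ρ => ?_⟩
    · rw [map_mul]; exact (ρ.isPythagorean.proj v).isIdempotentElem
    · rw [map_star]; exact (ρ.isPythagorean.proj v).isSelfAdjoint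
  orth v w h := repProduct_ext Λ fun ρ => by
    rw [map_mul, map_zero]; exact ρ.isPythagorean.orth v w h
  sum v m := repProduct_ext Λ fun ρ => by
    simp only [map_sum, map_mul, map_star]; exact ρ.isPythagorean.sum v m
  comp μ ν := repProduct_ext Λ fun ρ => by
    rw [map_mul]; exact ρ.isPythagorean.comp μ ν

/-- The C*-subalgebra generated by the family of all images of the generators. -/
noncomputable def pSubalgebra.{u, w₁, w₂} {k : ℕ} {V : Type w₁} [Category.{w₂} V]
    (Λ : KGraph k V) [Λ.RowFinite] : NonUnitalStarSubalgebra ℂ (RepProduct.{u} Λ) :=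
  (NonUnitalStarAlgebra.adjoin ℂ (Set.range (repGen.{u} Λ))).topologicalClosure

/-- The Pythagorean algebra `P_Λ`: the universal C*-algebra generated by `(a_λ)` subject to the
Pythagorean relations, realised as the C*-algebra generated by the direct sum of all
Hilbert-space representations of these relations (see `isPythagorean_gen` and
`existsUnique_lift` for the universal property). -/
def PAlgebra.{u, w₁, w₂} {k : ℕ} {V : Type w₁} [Category.{w₂} V] (Λ : KGraph k V)
    [Λ.RowFinite] : Type (max (u + 1) w₁ w₂) :=
  pSubalgebra.{u} Λ

noncomputable instance PAlgebra.instNonUnitalCStarAlgebra.{u, w₁, w₂} {k : ℕ} {V : Type w₁}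
    [Category.{w₂} V] (Λ : KGraph k V) [Λ.RowFinite] :
    NonUnitalCStarAlgebra (PAlgebra.{u} Λ) :=
  NonUnitalStarSubalgebra.nonUnitalCStarAlgebra (pSubalgebra.{u} Λ)
    (h_closed := NonUnitalStarSubalgebra.isClosed_topologicalClosure _)

/-- The generator `a_λ` of `P_Λ`. -/
noncomputable def gen.{u, w₁, w₂} {k : ℕ} {V : Type w₁} [Category.{w₂} V] (Λ : KGraph k V)
    [Λ.RowFinite] (p : GPath V) : PAlgebra.{u} Λ :=
  (⟨repGen Λ p, NonUnitalStarSubalgebra.le_topologicalClosure _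
    (NonUnitalStarAlgebra.subset_adjoin ℂ _ ⟨p, rfl⟩)⟩ : pSubalgebra.{u} Λ)

/-- The inclusion of `P_Λ` in the product. -/
noncomputable def pIncl.{u, w₁, w₂} {k : ℕ} {V : Type w₁} [Category.{w₂} V] (Λ : KGraph k V)
    [Λ.RowFinite] : PAlgebra.{u} Λ →⋆ₙₐ[ℂ] RepProduct.{u} Λ where
  toFun x := x.1
  map_smul' _ _ := rfl
  map_zero' := rfl
  map_add' _ _ := rfl
  map_mul' _ _ := rfl
  map_star' _ := rfl

theorem pIncl_injective.{u, w₁, w₂} {k : ℕ} {V : Type w₁} [Category.{w₂} V] (Λ : KGraph k V)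
    [Λ.RowFinite] : Function.Injective (pIncl.{u} Λ) :=
  Subtype.val_injective

theorem isPythagorean_gen.{u, w₁, w₂} {k : ℕ} {V : Type w₁} [Category.{w₂} V]
    (Λ : KGraph k V) [Λ.RowFinite] : Λ.IsPythagorean (gen.{u} Λ) where
  proj v := by
    refine ⟨pIncl_injective Λ ?_, pIncl_injective Λ ?_⟩
    · rw [map_mul]; exact ((isPythagorean_repGen Λ).proj v).isIdempotentElem
    · rw [map_star]; exact ((isPythagorean_repGen Λ).proj v).isSelfAdjoint
  orth v w h := pIncl_injective Λ <| by
    rw [map_mul, map_zero]; exact (isPythagorean_repGen Λ).orth v w h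
  sum v m := pIncl_injective Λ <| by
    simp only [map_sum, map_mul, map_star]; exact (isPythagorean_repGen Λ).sum v m
  comp μ ν := pIncl_injective Λ <| by
    rw [map_mul]; exact (isPythagorean_repGen Λ).comp μ ν

/-- The universal property of `P_Λ`. -/
theorem existsUnique_lift.{u, w₁, w₂} {k : ℕ} {V : Type w₁} [Category.{w₂} V]
    (Λ : KGraph k V) [Λ.RowFinite] {H : Type u} [NormedAddCommGroup H] [InnerProductSpace ℂ H]
    [CompleteSpace H] (A : GPath V → H →L[ℂ] H) (hA : Λ.IsPythagorean A) :
    ∃! π : PAlgebra.{u} Λ →⋆ₙₐ[ℂ] (H →L[ℂ] H), ∀ p, π (gen Λ p) = A p := by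
  refine ⟨(repEval Λ ⟨H, A, hA⟩).comp (pIncl Λ), fun p => rfl, fun π hπ => ?_⟩
  set π₀ : PAlgebra.{u} Λ →⋆ₙₐ[ℂ] (H →L[ℂ] H) := (repEval Λ ⟨H, A, hA⟩).comp (pIncl Λ)
  have hcont : Continuous π :=
    AddMonoidHomClass.continuous_of_bound π 1 fun x => by
      simpa using NonUnitalStarAlgHom.norm_apply_le π x
  have hcont₀ : Continuous π₀ :=
    AddMonoidHomClass.continuous_of_bound π₀ 1 fun x => by
      simpa using NonUnitalStarAlgHom.norm_apply_le π₀ x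
  refine NonUnitalStarAlgHom.ext fun x => ?_
  have hdense : x ∈ closure {y : PAlgebra.{u} Λ |
      pIncl Λ y ∈ NonUnitalStarAlgebra.adjoin ℂ (Set.range (repGen.{u} Λ))} := by
    rw [show {y : PAlgebra.{u} Λ |
      pIncl Λ y ∈ NonUnitalStarAlgebra.adjoin ℂ (Set.range (repGen.{u} Λ))} =
      (Subtype.val : pSubalgebra.{u} Λ → RepProduct.{u} Λ) ⁻¹'
        (NonUnitalStarAlgebra.adjoin ℂ (Set.range (repGen.{u} Λ)) : Set _) from rfl]
    refine (closure_subtype (x := (x : pSubalgebra.{u} Λ))).2 ?_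
    rw [Set.image_preimage_eq_of_subset]
    · exact x.2
    · rw [Subtype.range_coe]
      exact NonUnitalStarSubalgebra.le_topologicalClosure _
  refine closure_minimal (t := {y | π y = π₀ y}) ?_ (isClosed_eq hcont hcont₀) hdense
  have key : ∀ z (hz : z ∈ NonUnitalStarAlgebra.adjoin ℂ (Set.range (repGen.{u} Λ))),
      ∃ y : PAlgebra.{u} Λ, pIncl Λ y = z ∧ π y = π₀ y := by
    intro z hz
    induction hz using NonUnitalStarAlgebra.adjoin_induction with
    | mem z hz => obtain ⟨p, rfl⟩ := hz; exact ⟨gen Λ p, rfl, hπ p⟩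
    | add a b _ _ ha hb =>
      obtain ⟨a, rfl, ha⟩ := ha
      obtain ⟨b, rfl, hb⟩ := hb
      exact ⟨a + b, map_add _ _ _, by rw [map_add, map_add, ha, hb]⟩
    | zero => exact ⟨0, map_zero _, by rw [map_zero, map_zero]⟩
    | mul a b _ _ ha hb =>
      obtain ⟨a, rfl, ha⟩ := ha
      obtain ⟨b, rfl, hb⟩ := hb
      exact ⟨a * b, map_mul _ _ _, by rw [map_mul, map_mul, ha, hb]⟩
    | smul c a _ ha =>
      obtain ⟨a, rfl, ha⟩ := ha
      exact ⟨c • a, map_smul _ _ _, by rw [map_smul, map_smul, ha]⟩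
    | star a _ ha =>
      obtain ⟨a, rfl, ha⟩ := ha
      exact ⟨star a, map_star _ _, by rw [map_star, map_star, ha]⟩
  intro y hy
  obtain ⟨y', hy', h⟩ := key _ hy
  rw [pIncl_injective Λ hy'] at h
  exact h

/-! ### The non-self-adjoint algebra and its modules -/

theorem gen_mul_gen_mem.{u, w₁, w₂} {k : ℕ} {V : Type w₁} [Category.{w₂} V]
    (Λ : KGraph k V) [Λ.RowFinite] (p q : GPath V) :
    gen.{u} Λ p * gen.{u} Λ q ∈ Submodule.span ℂ (Set.range (gen.{u} Λ)) := by
  have h := isPythagorean_gen.{u} Λ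
  obtain ⟨u, v, μ⟩ := p
  obtain ⟨v', w, ν⟩ := q
  by_cases hv : v = v'
  · subst hv
    rw [h.comp]
    exact Submodule.subset_span ⟨_, rfl⟩
  · have h1 : gen.{u} Λ ⟨u, v, μ⟩ = gen Λ ⟨u, v, μ⟩ * gen Λ (Λ.vtx v) := by
      rw [vtx, h.comp, Category.comp_id]
    have h2 : gen.{u} Λ ⟨v', w, ν⟩ = gen Λ (Λ.vtx v') * gen Λ ⟨v', w, ν⟩ := by
      rw [vtx, h.comp, Category.id_comp]
    rw [h1, h2, mul_assoc, ← mul_assoc (gen Λ (Λ.vtx v)), h.orth v v' hv, zero_mul, mul_zero]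
    exact Submodule.zero_mem _

theorem span_gen_mul_mem.{u, w₁, w₂} {k : ℕ} {V : Type w₁} [Category.{w₂} V]
    (Λ : KGraph k V) [Λ.RowFinite] {x y : PAlgebra.{u} Λ}
    (hx : x ∈ Submodule.span ℂ (Set.range (gen.{u} Λ)))
    (hy : y ∈ Submodule.span ℂ (Set.range (gen.{u} Λ))) :
    x * y ∈ Submodule.span ℂ (Set.range (gen.{u} Λ)) := by
  induction hx using Submodule.span_induction with
  | mem x hx =>
    obtain ⟨p, rfl⟩ := hx
    induction hy using Submodule.span_induction with
    | mem y hy => obtain ⟨q, rfl⟩ := hy; exact gen_mul_gen_mem Λ p q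
    | zero => rw [mul_zero]; exact Submodule.zero_mem _
    | add a b _ _ ha hb => rw [mul_add]; exact Submodule.add_mem _ ha hb
    | smul c a _ ha => rw [mul_smul_comm]; exact Submodule.smul_mem _ c ha
  | zero => rw [zero_mul]; exact Submodule.zero_mem _
  | add a b _ _ ha hb => rw [add_mul]; exact Submodule.add_mem _ ha hb
  | smul c a _ ha => rw [smul_mul_assoc]; exact Submodule.smul_mem _ c ha

/-- The algebra `A_Λ`: the closed linear span of `{a_λ : λ ∈ Λ}` in `P_Λ`. -/
noncomputable def aAlgebra.{u, w₁, w₂} {k : ℕ} {V : Type w₁} [Category.{w₂} V] (Λ : KGraph k V)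
    [Λ.RowFinite] : NonUnitalSubalgebra ℂ (PAlgebra.{u} Λ) where
  __ := (Submodule.span ℂ (Set.range (gen.{u} Λ))).topologicalClosure
  mul_mem' {_ _} hx hy := map_mem_closure₂ continuous_mul hx hy
    fun _ ha _ hb => span_gen_mul_mem Λ ha hb

/-- The generator `a_λ` as an element of `A_Λ`. -/
noncomputable def aGen.{u, w₁, w₂} {k : ℕ} {V : Type w₁} [Category.{w₂} V] (Λ : KGraph k V)
    [Λ.RowFinite] (p : GPath V) : aAlgebra.{u} Λ :=
  ⟨gen Λ p, subset_closure (Submodule.subset_span ⟨p, rfl⟩)⟩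

/-- The structure of a (nondegenerate) `A_Λ`-module on a Hilbert space `H`: a continuous algebra
homomorphism `π : A_Λ → B(H)` such that each `π(a_v)` is an orthogonal projection and
`∑_{λ ∈ vΛ^{e_j}} π(a_λ)^* π(a_λ) = π(a_v)` whenever `vΛ^{e_j}` is nonempty, and such that the
finite sums of the `π(a_v)` converge to the identity in the weak operator topology. -/
structure AModule.{u, w₁, w₂} {k : ℕ} {V : Type w₁} [Category.{w₂} V] (Λ : KGraph k V)
    [Λ.RowFinite] (H : Type u) [NormedAddCommGroup H] [InnerProductSpace ℂ H]
    [CompleteSpace H] where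
  π : aAlgebra.{u} Λ →ₙₐ[ℂ] (H →L[ℂ] H)
  continuous_π : Continuous π
  proj : ∀ v : V, IsStarProjection (π (aGen Λ (Λ.vtx v)))
  sum : ∀ (v : V) (j : Fin k), (Λ.edges v j).Nonempty →
    ∑ p ∈ (Λ.edges_finite v j).toFinset, star (π (aGen Λ p)) * π (aGen Λ p) =
      π (aGen Λ (Λ.vtx v))
  nondegenerate : ∀ ξ η : H,
    HasSum (fun v : V => ⟪ξ, π (aGen Λ (Λ.vtx v)) η⟫_ℂ) ⟪ξ, η⟫_ℂ

/-! ### Trees -/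

/-- The caret `∨_{v,i} = vΛ^{≤ e_i}`: it is `vΛ^{e_i}` if this set is nonempty, and `{v}`
otherwise. -/
def caret (v : V) (i : Fin k) : Set (GPath V) :=
  {p | p ∈ Λ.edges v i ∨ (Λ.edges v i = ∅ ∧ p = Λ.vtx v)}

/-- The set `μS = {μ ∘ ν : ν ∈ S, r(ν) = s(μ)}`. -/
def compSet (_ : KGraph k V) (μ : GPath V) (S : Set (GPath V)) : Set (GPath V) :=
  {p | ∃ (u : V) (ν : u ⟶ μ.src), (⟨u, μ.src, ν⟩ : GPath V) ∈ S ∧ p = ⟨u, μ.rng, ν ≫ μ.hom⟩}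

/-- The trees at `v`, as sets of leaves. -/
inductive IsTree (v : V) : Set (GPath V) → Prop
  | trivial : IsTree v {Λ.vtx v}
  | graft (t : Set (GPath V)) (μ : GPath V) (i : Fin k) : IsTree v t → μ ∈ t →
      IsTree v ((t \ {μ}) ∪ Λ.compSet μ (Λ.caret μ.src i))

/-! ### Submodules -/

namespace AModule

universe u w₁ w₂

variable {k : ℕ} {V : Type w₁} [Category.{w₂} V] {Λ : KGraph k V} [Λ.RowFinite]
  {H : Type u} [NormedAddCommGroup H] [InnerProductSpace ℂ H] [CompleteSpace H]
  (M : Λ.AModule H)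

/-- The operator `A_λ = π(a_λ)`. -/
noncomputable def op (p : GPath V) : H →L[ℂ] H := M.π (aGen Λ p)

/-- `K` is a submodule: a closed subspace that is invariant under `A_Λ`. -/
def IsSubmodule (K : Submodule ℂ H) : Prop :=
  IsClosed (K : Set H) ∧ ∀ x : aAlgebra.{u} Λ, ∀ ξ ∈ K, M.π x ξ ∈ K

/-- A subspace is residual if it contains no nonzero submodule. -/
def IsResidual (Z : Submodule ℂ H) : Prop :=
  ∀ K : Submodule ℂ H, M.IsSubmodule K → K ≤ Z → K = ⊥

/-- A submodule is weakly complete if its orthogonal complement is residual. -/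
def IsWeaklyComplete (H' : Submodule ℂ H) : Prop := M.IsResidual H'ᗮ

/-- Completeness: for every `ε > 0`, every vertex `v` and every `ξ ∈ H_v = π(a_v)H` there are a
tree `t` at `v` and vectors `η_μ ∈ H'`, for `μ ∈ t`, with `∑_{μ ∈ t} ‖A_μ ξ - η_μ‖² < ε²`. -/
def IsComplete (H' : Submodule ℂ H) : Prop :=
  ∀ ε : ℝ, 0 < ε → ∀ v : V, ∀ ξ ∈ (M.op (Λ.vtx v)).range,
    ∃ t : Finset (GPath V), Λ.IsTree v (t : Set (GPath V)) ∧
      ∃ η : GPath V → H, (∀ μ ∈ t, η μ ∈ H') ∧ ∑ μ ∈ t, ‖M.op μ ξ - η μ‖ ^ 2 < ε ^ 2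

end AModule

end KGraph

/-! Let `P` be the orthogonal projection onto the complement of `H'`.

Complete implies weakly complete: the leaves of a tree at `v` split the squared norm of a vector `ξ`
of `H_v`. If `ξ` lies in a submodule orthogonal to `H'`, then all `A_μ ξ` are orthogonal to `H'`, so
no choice of `η_μ` brings the sum below `‖ξ‖²`.

Weakly complete implies complete: start from the squared distance `‖P A_v ξ‖²` to `H'` and apply
transfer operators `T_i`, which replace a function by its sum over the caret of colour `i`. They
commute (`transfer_comm`, from unique factorisation and local convexity), so the iterates are
indexed by multisets of colours. They decrease (`defect_antitone`), because `H'` is invariant and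
carets split norms. Each iterate bounds the error achieved by some tree
(`exists_isTree_sum_le_defect`). If `H'` is not complete, the limit `F` is therefore positive
somewhere.

`F` is homogeneous of degree two and upper semicontinuous, and only finitely many vertices matter in
finite dimension, so `F(v, ξ) / ‖ξ‖²` attains a maximum `c > 0`. At a maximiser `ξ`, `c‖ξ‖² = F(v,
ξ) ≤ ∑ F(s(ν), A_ν ξ) ≤ c ∑ ‖A_ν ξ‖² ≤ c‖ξ‖²`, so equality holds in every term and it propagates
along all paths (`limitDefect_op_eq`). Since `F(v, ξ) = F(v, Pξ) ≤ c‖Pξ‖²`, equality also forces `ξ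
= Pξ`. Hence all `A_p ξ` with `r(p) = v` are orthogonal to `H'`, and they generate a submodule that
weak completeness forbids. -/

/-! ### Concatenation of paths -/

namespace GPath

variable {V : Type*} [Category V]

open Classical in
/-- The concatenation `μ ∘ ν` if `r(ν) = s(μ)`, and the junk value `ν` otherwise. -/
noncomputable def extend (μ ν : GPath V) : GPath V :=
  if h : ν.rng = μ.src then ⟨ν.src, μ.rng, ν.hom ≫ eqToHom h ≫ μ.hom⟩ else ν

@[simp] theorem extend_mk {u v w : V} (n : u ⟶ v) (m : v ⟶ w) :
    extend ⟨v, w, m⟩ ⟨u, v, n⟩ = ⟨u, w, n ≫ m⟩ := by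
  simp [extend]

@[simp] theorem extend_src (μ ν : GPath V) : (extend μ ν).src = ν.src := by
  unfold extend; split_ifs <;> rfl

theorem extend_rng {μ ν : GPath V} (h : ν.rng = μ.src) : (extend μ ν).rng = μ.rng := by
  simp [extend, h]

theorem extend_assoc {μ ν α : GPath V} (h : ν.rng = μ.src) (h' : α.rng = ν.src) :
    extend (extend μ ν) α = extend μ (extend ν α) := by
  obtain ⟨v, w, m⟩ := μ
  obtain ⟨u, v', n⟩ := ν
  obtain ⟨x, u', a⟩ := α
  simp only at h h'
  subst h h'
  simp

end GPath

namespace KGraph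

open GPath

variable {k : ℕ} {V : Type*} [Category V] (Λ : KGraph k V)

theorem extend_vtx (μ : GPath V) : extend μ (Λ.vtx μ.src) = μ := by
  obtain ⟨v, w, m⟩ := μ
  simp [vtx]

theorem d_extend {μ ν : GPath V} (h : ν.rng = μ.src) : Λ.d (extend μ ν) = Λ.d μ + Λ.d ν := by
  obtain ⟨v, w, m⟩ := μ
  obtain ⟨u, v', n⟩ := ν
  simp only at h
  subst h
  rw [extend_mk]
  exact Λ.deg_comp n m

theorem extend_inj {μ ν μ' ν' : GPath V} (h : ν.rng = μ.src) (h' : ν'.rng = μ'.src)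
    (hd : Λ.d μ = Λ.d μ') (he : extend μ ν = extend μ' ν') : μ = μ' ∧ ν = ν' := by
  have hdν : Λ.d ν = Λ.d ν' := by
    have := congrArg Λ.d he
    rw [Λ.d_extend h, Λ.d_extend h', hd] at this
    exact add_left_cancel this
  obtain ⟨v, w, m⟩ := μ
  obtain ⟨u, _, n⟩ := ν
  obtain ⟨v', w', m'⟩ := μ'
  obtain ⟨u', _, n'⟩ := ν'
  simp only at h h'
  subst h h'
  simp only [extend_mk, GPath.mk.injEq] at he
  obtain ⟨rfl, rfl, he⟩ := he
  have he := eq_of_heq he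
  have hu := (Λ.factorisation (n ≫ m) (Λ.deg m) (Λ.deg n) (Λ.deg_comp n m)).unique
    (y₁ := ⟨_, n, m⟩) (y₂ := ⟨_, n', m'⟩) ⟨rfl, rfl, rfl⟩ ⟨he.symm, hd.symm, hdν.symm⟩
  rw [Sigma.mk.injEq] at hu
  obtain ⟨rfl, hu⟩ := hu
  have hu := eq_of_heq hu
  rw [Prod.mk.injEq] at hu
  obtain ⟨rfl, rfl⟩ := hu
  exact ⟨rfl, rfl⟩

theorem exists_extend_eq (p : GPath V) {m n : Fin k → ℕ} (h : Λ.d p = m + n) :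
    ∃ μ ν : GPath V, ν.rng = μ.src ∧ Λ.d μ = m ∧ Λ.d ν = n ∧ extend μ ν = p := by
  obtain ⟨u, v, f⟩ := p
  obtain ⟨⟨x, a, b⟩, ⟨hab, hb, ha⟩, -⟩ := Λ.factorisation f m n h
  refine ⟨⟨x, v, b⟩, ⟨u, x, a⟩, rfl, hb, ha, ?_⟩
  simp only at hab
  simp [hab]

/-- The factorisations `p = p s(p) = r(p) p` both split the degree as `0 + 0`, so they coincide. -/
theorem eq_vtx_of_d_eq_zero {p : GPath V} (h : Λ.d p = 0) : p = Λ.vtx p.rng := by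
  obtain ⟨u, v, f⟩ := p
  have h1 : extend ⟨u, v, f⟩ (Λ.vtx u) = extend (Λ.vtx v) ⟨u, v, f⟩ := by simp [vtx]
  exact (Λ.extend_inj rfl rfl (by rw [h]; exact (Λ.deg_id v).symm) h1).1

/-! ### Carets -/

theorem caret_finite [Λ.RowFinite] (v : V) (i : Fin k) : (Λ.caret v i).Finite :=
  ((Λ.edges_finite v i).union (Set.finite_singleton (Λ.vtx v))).subset fun _ hp =>
    hp.imp id fun h => h.2

/-- The caret at `v` of colour `i`, as a finite set. -/
noncomputable def caretFinset [Λ.RowFinite] (v : V) (i : Fin k) : Finset (GPath V) :=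
  (Λ.caret_finite v i).toFinset

@[simp] theorem mem_caretFinset [Λ.RowFinite] {v : V} {i : Fin k} {p : GPath V} :
    p ∈ Λ.caretFinset v i ↔ p ∈ Λ.caret v i := by
  simp [caretFinset]

theorem rng_of_mem_caret {v : V} {i : Fin k} {p : GPath V} (h : p ∈ Λ.caret v i) :
    p.rng = v := by
  rcases h with h | ⟨-, rfl⟩
  · exact h.1
  · rfl

theorem caretFinset_of_empty [Λ.RowFinite] {v : V} {i : Fin k} (h : Λ.edges v i = ∅) :
    Λ.caretFinset v i = {Λ.vtx v} := by
  ext p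
  simp [caret, h]

theorem caretFinset_of_nonempty [Λ.RowFinite] {v : V} {i : Fin k} (h : (Λ.edges v i).Nonempty) :
    Λ.caretFinset v i = (Λ.edges_finite v i).toFinset := by
  ext p
  simp [caret, h.ne_empty]

theorem d_eq_of_mem_caret {v : V} {i : Fin k} {p q : GPath V} (hp : p ∈ Λ.caret v i)
    (hq : q ∈ Λ.caret v i) : Λ.d p = Λ.d q := by
  rcases hp with hp | ⟨h, rfl⟩
  · rcases hq with hq | ⟨h', rfl⟩
    · exact hp.2.trans hq.2.symm
    · rw [h'] at hp; exact hp.elim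
  · rcases hq with hq | ⟨h', rfl⟩
    · rw [h] at hq; exact hq.elim
    · rfl

/-- An edge of colour `i` after an edge of colour `j` gives a path of degree `e_i + e_j`.
Refactoring it in the other order produces an edge of colour `i` at `v`. -/
theorem edges_src_eq_empty {v : V} {i j : Fin k} (h : Λ.edges v i = ∅) {p : GPath V}
    (hp : p ∈ Λ.caret v j) : Λ.edges p.src i = ∅ := by
  rcases hp with ⟨hr, hd⟩ | ⟨-, rfl⟩
  · by_contra hne
    obtain ⟨q, hq⟩ := Set.nonempty_iff_ne_empty.2 hne
    obtain ⟨μ, ν, hνμ, hμ, -, he⟩ := Λ.exists_extend_eq (extend p q)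
      (m := Pi.single i 1) (n := Pi.single j 1) (by
        rw [Λ.d_extend hq.1, hd, hq.2, add_comm])
    have : μ ∈ Λ.edges v i := by
      refine ⟨?_, hμ⟩
      rw [← extend_rng hνμ, he, extend_rng hq.1, hr]
    rw [h] at this
    exact this
  · exact h

/-- By unique factorisation, concatenation is a bijection onto the paths of degree `e_i + e_j`, a
set that is symmetric in the two colours. -/
theorem sum_edges_sum_edges [Λ.RowFinite] (v : V) (i j : Fin k) (g : GPath V → ℝ) :
    ∑ μ ∈ (Λ.edges_finite v i).toFinset, ∑ ν ∈ (Λ.edges_finite μ.src j).toFinset,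
      g (extend μ ν) =
    ∑ p ∈ (Λ.pathsOfDegree_finite _ v (Pi.single i 1 + Pi.single j 1) rfl).toFinset, g p := by
  rw [Finset.sum_sigma']
  refine Finset.sum_bij (fun x _ => extend x.1 x.2) ?_ ?_ ?_ fun _ _ => rfl
  · rintro ⟨μ, ν⟩ h
    simp only [Finset.mem_sigma, Set.Finite.mem_toFinset] at h ⊢
    exact ⟨(extend_rng h.2.1).trans h.1.1, by rw [Λ.d_extend h.2.1, h.1.2, h.2.2]⟩
  · rintro ⟨μ, ν⟩ h ⟨μ', ν'⟩ h' he
    simp only [Finset.mem_sigma, Set.Finite.mem_toFinset] at h h'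
    obtain ⟨rfl, rfl⟩ := Λ.extend_inj h.2.1 h'.2.1 (h.1.2.trans h'.1.2.symm) he
    rfl
  · intro p hp
    simp only [Set.Finite.mem_toFinset] at hp
    obtain ⟨μ, ν, hνμ, hμ, hν, rfl⟩ := Λ.exists_extend_eq p hp.2
    refine ⟨⟨μ, ν⟩, ?_, rfl⟩
    simp only [Finset.mem_sigma, Set.Finite.mem_toFinset]
    exact ⟨⟨(extend_rng hνμ).symm.trans hp.1, hμ⟩, hνμ, hν⟩

/-- This is where local convexity enters: following an edge of one colour cannot make another
available colour disappear. -/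
theorem edges_src_nonempty [Λ.LocallyConvex] {v : V} {i j : Fin k} (hij : i ≠ j)
    (hj : (Λ.edges v j).Nonempty) {μ : GPath V} (hμ : μ ∈ Λ.edges v i) :
    (Λ.edges μ.src j).Nonempty := by
  obtain ⟨ν, hν⟩ := hj
  rcases lt_or_gt_of_ne hij with h | h
  · exact (LocallyConvex.convex (Λ := Λ) i j h v μ hμ ν hν).1
  · exact (LocallyConvex.convex (Λ := Λ) j i h v ν hν μ hμ).2

theorem sum_caret_comm_of_empty [Λ.RowFinite] {v : V} {i j : Fin k} (h : Λ.edges v i = ∅)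
    (g : GPath V → ℝ) :
    ∑ μ ∈ Λ.caretFinset v i, ∑ ν ∈ Λ.caretFinset μ.src j, g (extend μ ν) =
      ∑ μ ∈ Λ.caretFinset v j, ∑ ν ∈ Λ.caretFinset μ.src i, g (extend μ ν) := by
  rw [Λ.caretFinset_of_empty h, Finset.sum_singleton]
  refine Finset.sum_congr rfl fun μ hμ => ?_
  have hμ' : μ ∈ Λ.caret v j := by rw [← mem_caretFinset]; exact hμ
  rw [Λ.caretFinset_of_empty (Λ.edges_src_eq_empty h hμ'), Finset.sum_singleton, Λ.extend_vtx]
  have hr := Λ.rng_of_mem_caret hμ'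
  obtain ⟨u, w, m⟩ := μ
  simp only at hr
  subst hr
  simp [vtx]

/-- The sets of concatenations of a caret of colour `i` and carets of colour `j` do not depend
on the order of the two colours. -/
theorem sum_caret_comm [Λ.RowFinite] [Λ.LocallyConvex] (v : V) (i j : Fin k)
    (g : GPath V → ℝ) :
    ∑ μ ∈ Λ.caretFinset v i, ∑ ν ∈ Λ.caretFinset μ.src j, g (extend μ ν) =
      ∑ μ ∈ Λ.caretFinset v j, ∑ ν ∈ Λ.caretFinset μ.src i, g (extend μ ν) := by
  rcases eq_or_ne i j with rfl | hij
  · rfl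
  rcases (Λ.edges v i).eq_empty_or_nonempty with hi | hi
  · exact Λ.sum_caret_comm_of_empty hi g
  rcases (Λ.edges v j).eq_empty_or_nonempty with hj | hj
  · exact (Λ.sum_caret_comm_of_empty hj g).symm
  have key : ∀ a b : Fin k, a ≠ b → (Λ.edges v a).Nonempty → (Λ.edges v b).Nonempty →
      ∑ μ ∈ Λ.caretFinset v a, ∑ ν ∈ Λ.caretFinset μ.src b, g (extend μ ν) =
      ∑ p ∈ (Λ.pathsOfDegree_finite _ v (Pi.single a 1 + Pi.single b 1) rfl).toFinset, g p := by
    intro a b hab ha hb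
    rw [← Λ.sum_edges_sum_edges, Λ.caretFinset_of_nonempty ha]
    refine Finset.sum_congr rfl fun μ hμ => ?_
    rw [Λ.caretFinset_of_nonempty (Λ.edges_src_nonempty hab hb (by simpa using hμ))]
  rw [key i j hij hi hj, key j i hij.symm hj hi]
  refine Finset.sum_congr ?_ fun _ _ => rfl
  ext p
  simp [add_comm]

/-! ### Trees -/

open Classical in
theorem coe_image_extend [Λ.RowFinite] (μ : GPath V) (i : Fin k) :
    (((Λ.caretFinset μ.src i).image (extend μ) : Finset (GPath V)) : Set (GPath V)) =
      Λ.compSet μ (Λ.caret μ.src i) := by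
  ext p
  simp only [Finset.coe_image, Set.mem_image, Finset.mem_coe, mem_caretFinset, compSet,
    Set.mem_ofPred_eq]
  constructor
  · rintro ⟨ν, hν, rfl⟩
    have hr := Λ.rng_of_mem_caret hν
    obtain ⟨u, w, n⟩ := ν
    simp only at hr
    subst hr
    exact ⟨u, n, hν, extend_mk _ _⟩
  · rintro ⟨u, n, hν, rfl⟩
    exact ⟨_, hν, extend_mk _ _⟩

theorem extend_injOn [Λ.RowFinite] (μ : GPath V) (i : Fin k) :
    Set.InjOn (extend μ) (Λ.caretFinset μ.src i : Set (GPath V)) := by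
  intro ν hν ν' hν' he
  simp only [Finset.mem_coe, mem_caretFinset] at hν hν'
  exact (Λ.extend_inj (Λ.rng_of_mem_caret hν) (Λ.rng_of_mem_caret hν') rfl he).2

end KGraph
namespace KGraph.AModule

open GPath

universe u w₁ w₂

variable {k : ℕ} {V : Type w₁} [Category.{w₂} V] {Λ : KGraph k V} [Λ.RowFinite]
  {H : Type u} [NormedAddCommGroup H] [InnerProductSpace ℂ H] [CompleteSpace H]
  (M : Λ.AModule H)

/-! ### The operators of a module -/

theorem op_mul_op {x y z : V} (μ : x ⟶ y) (ν : y ⟶ z) :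
    M.op ⟨x, y, μ⟩ * M.op ⟨y, z, ν⟩ = M.op ⟨x, z, μ ≫ ν⟩ := by
  unfold op
  rw [← map_mul]
  exact congrArg M.π (Subtype.ext ((isPythagorean_gen Λ).comp μ ν))

theorem op_extend {μ ν : GPath V} (h : ν.rng = μ.src) (ξ : H) :
    M.op (extend μ ν) ξ = M.op ν (M.op μ ξ) := by
  obtain ⟨v, w, m⟩ := μ
  obtain ⟨u, v', n⟩ := ν
  simp only at h
  subst h
  rw [extend_mk, ← M.op_mul_op]
  rfl

theorem op_vtx_src (p : GPath V) (ξ : H) : M.op (Λ.vtx p.src) (M.op p ξ) = M.op p ξ := by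
  rw [← M.op_extend rfl, Λ.extend_vtx]

theorem op_vtx_rng (p : GPath V) (ξ : H) : M.op p (M.op (Λ.vtx p.rng) ξ) = M.op p ξ := by
  rw [← M.op_extend rfl]
  obtain ⟨v, w, m⟩ := p
  simp [vtx]

theorem op_vtx_op_vtx (v : V) (ξ : H) :
    M.op (Λ.vtx v) (M.op (Λ.vtx v) ξ) = M.op (Λ.vtx v) ξ :=
  M.op_vtx_src (Λ.vtx v) ξ

theorem op_vtx_op_vtx_of_ne {v w : V} (h : v ≠ w) (ξ : H) :
    M.op (Λ.vtx v) (M.op (Λ.vtx w) ξ) = 0 := by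
  have h0 : aGen Λ (Λ.vtx v) * aGen Λ (Λ.vtx w) = 0 :=
    Subtype.ext ((isPythagorean_gen Λ).orth v w h)
  have h1 := congrArg (fun x => M.π x ξ) h0
  simp only [map_mul, map_zero] at h1
  exact h1

theorem op_op_of_ne {p q : GPath V} (h : p.rng ≠ q.src) (ξ : H) : M.op p (M.op q ξ) = 0 := by
  rw [← M.op_vtx_src q, ← M.op_vtx_rng p, M.op_vtx_op_vtx_of_ne h, map_zero]

theorem norm_op_vtx_le (v : V) (ξ : H) : ‖M.op (Λ.vtx v) ξ‖ ≤ ‖ξ‖ := by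
  simpa using (M.op (Λ.vtx v)).le_of_opNorm_le (M.proj v).norm_le ξ

theorem inner_op_vtx (v : V) (ξ η : H) :
    ⟪M.op (Λ.vtx v) ξ, η⟫_ℂ = ⟪ξ, M.op (Λ.vtx v) η⟫_ℂ := by
  have h : star (M.op (Λ.vtx v)) = M.op (Λ.vtx v) := (M.proj v).isSelfAdjoint
  conv_rhs => rw [← h, ContinuousLinearMap.star_eq_adjoint]
  rw [ContinuousLinearMap.adjoint_inner_right]

/-- A trivial caret contributes its only term. Otherwise this is the module relation `∑ A_ν^* A_ν =
A_v` paired with `ξ`. -/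
theorem sum_caret_norm_sq (v : V) (i : Fin k) (ξ : H) :
    ∑ ν ∈ Λ.caretFinset v i, ‖M.op ν ξ‖ ^ 2 = ‖M.op (Λ.vtx v) ξ‖ ^ 2 := by
  rcases (Λ.edges v i).eq_empty_or_nonempty with hi | hi
  · rw [Λ.caretFinset_of_empty hi, Finset.sum_singleton]
  · have key : ∀ (T : H →L[ℂ] H) (x : H), RCLike.re ⟪(star T * T) x, x⟫_ℂ = ‖T x‖ ^ 2 := by
      intro T x
      rw [ContinuousLinearMap.star_eq_adjoint]
      exact (T.apply_norm_sq_eq_inner_adjoint_left x).symm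
    have hproj : star (M.op (Λ.vtx v)) * M.op (Λ.vtx v) = M.op (Λ.vtx v) := by
      rw [show star (M.op (Λ.vtx v)) = M.op (Λ.vtx v) from (M.proj v).isSelfAdjoint]
      exact (M.proj v).isIdempotentElem
    have hs := M.sum v i hi
    rw [Λ.caretFinset_of_nonempty hi, ← key (M.op (Λ.vtx v)), hproj]
    simp only [← key]
    unfold op
    rw [← hs, _root_.sum_apply, sum_inner, map_sum]

/-- A subspace invariant under all `A_λ` is invariant under `A_Λ`, if it is closed. -/
theorem isSubmodule_of_op_mem {K : Submodule ℂ H} (hK : IsClosed (K : Set H))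
    (h : ∀ p, ∀ ξ ∈ K, M.op p ξ ∈ K) : M.IsSubmodule K := by
  refine ⟨hK, fun x ξ hξ => ?_⟩
  have hcont : Continuous fun y : aAlgebra.{u} Λ => M.π y ξ :=
    (ContinuousLinearMap.apply ℂ H ξ).continuous.comp M.continuous_π
  have hclosed : IsClosed {y : aAlgebra.{u} Λ | M.π y ξ ∈ K} := hK.preimage hcont
  -- The span lives in `P_Λ`, so the induction carries a lift to `A_Λ` along with the membership.
  have hspan : ∀ z ∈ Submodule.span ℂ (Set.range (gen.{u} Λ)),
      ∃ y : aAlgebra.{u} Λ, (y : PAlgebra.{u} Λ) = z ∧ M.π y ξ ∈ K := by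
    intro z hz
    induction hz using Submodule.span_induction with
    | mem z hz => obtain ⟨p, rfl⟩ := hz; exact ⟨aGen Λ p, rfl, h p ξ hξ⟩
    | zero => exact ⟨0, rfl, by simp⟩
    | add a b _ _ ha hb =>
      obtain ⟨a, rfl, ha⟩ := ha
      obtain ⟨b, rfl, hb⟩ := hb
      exact ⟨a + b, rfl, by rw [map_add]; exact K.add_mem ha hb⟩
    | smul c a _ ha =>
      obtain ⟨a, rfl, ha⟩ := ha
      exact ⟨c • a, rfl, by rw [map_smul]; exact K.smul_mem c ha⟩
  have hx : x ∈ closure ((Subtype.val : aAlgebra.{u} Λ → PAlgebra.{u} Λ) ⁻¹'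
      (Submodule.span ℂ (Set.range (gen.{u} Λ)) : Set (PAlgebra.{u} Λ))) := by
    refine closure_subtype.2 ?_
    rw [Set.image_preimage_eq_of_subset]
    · exact x.2
    · rw [Subtype.range_coe]
      exact subset_closure
  refine closure_minimal ?_ hclosed hx
  intro y hy
  obtain ⟨y', hy', hm⟩ := hspan _ hy
  rwa [Subtype.ext hy'] at hm

theorem IsSubmodule.op_mem {K : Submodule ℂ H} (hK : M.IsSubmodule K) (p : GPath V) {ξ : H}
    (hξ : ξ ∈ K) : M.op p ξ ∈ K := hK.2 _ ξ hξ

theorem exists_op_vtx_ne_zero {ξ : H} (h : ξ ≠ 0) : ∃ v, M.op (Λ.vtx v) ξ ≠ 0 := by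
  by_contra! h0
  have h1 := M.nondegenerate ξ ξ
  have h2 : (fun v : V => ⟪ξ, M.π (aGen Λ (Λ.vtx v)) ξ⟫_ℂ) = fun _ => 0 := by
    funext v
    have : M.π (aGen Λ (Λ.vtx v)) ξ = 0 := h0 v
    rw [this, inner_zero_right]
  rw [h2] at h1
  exact h (inner_self_eq_zero.1 (h1.unique hasSum_zero))

/-- Nonzero vectors chosen in the ranges of distinct `A_v` are orthogonal, hence linearly
independent. -/
theorem finite_setOf_op_vtx_ne_zero [FiniteDimensional ℂ H] :
    {v : V | M.op (Λ.vtx v) ≠ 0}.Finite := by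
  have hex : ∀ v : {v : V | M.op (Λ.vtx v) ≠ 0}, ∃ ξ, M.op (Λ.vtx v.1) ξ ≠ 0 := by
    rintro ⟨v, hv⟩
    by_contra! h
    exact hv (ContinuousLinearMap.ext h)
  choose e he using hex
  have hli : LinearIndependent ℂ fun v : {v : V | M.op (Λ.vtx v) ≠ 0} =>
      M.op (Λ.vtx v.1) (e v) := by
    refine linearIndependent_of_ne_zero_of_inner_eq_zero he fun v w hvw => ?_
    show ⟪M.op (Λ.vtx v.1) (e v), M.op (Λ.vtx w.1) (e w)⟫_ℂ = 0
    rw [M.inner_op_vtx, M.op_vtx_op_vtx_of_ne (fun h => hvw (Subtype.ext h)), inner_zero_right]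
  exact Set.finite_coe_iff.1 hli.finite_of_isNoetherian

/-! ### Complete submodules are weakly complete -/

open Classical in
/-- The leaves of a tree at `v` have no common extensions, and they split the norm of `A_v ξ`. -/
theorem exists_finset_of_isTree {v : V} {S : Set (GPath V)} (hS : Λ.IsTree v S) (ξ : H) :
    ∃ t : Finset (GPath V), (t : Set (GPath V)) = S ∧
      (∀ μ ∈ t, ∀ μ' ∈ t, ∀ α β : GPath V, α.rng = μ.src → β.rng = μ'.src →
        extend μ α = extend μ' β → μ = μ') ∧
      ∑ μ ∈ t, ‖M.op μ ξ‖ ^ 2 = ‖M.op (Λ.vtx v) ξ‖ ^ 2 := by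
  induction hS with
  | trivial =>
    refine ⟨{Λ.vtx v}, by simp, ?_, by simp⟩
    intro μ hμ μ' hμ' _ _ _ _ _
    simp only [Finset.mem_singleton] at hμ hμ'
    rw [hμ, hμ']
  | graft S μ i _ hμ ih =>
    obtain ⟨t, rfl, hdisj, hsum⟩ := ih
    have hμ : μ ∈ t := hμ
    -- An extension of a new leaf `μν` is also an extension of `μ`, so it cannot extend another old
    -- leaf.
    have hne : ∀ μ' ∈ t.erase μ, ∀ ν ∈ Λ.caretFinset μ.src i, ∀ α β : GPath V,
        α.rng = μ'.src → β.rng = (extend μ ν).src → extend μ' α ≠ extend (extend μ ν) β := by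
      intro μ' hμ' ν hν α β hα hβ he
      have hr := Λ.rng_of_mem_caret (Λ.mem_caretFinset.1 hν)
      rw [extend_src] at hβ
      rw [extend_assoc hr hβ] at he
      exact Finset.ne_of_mem_erase hμ' (hdisj μ' (Finset.mem_of_mem_erase hμ') μ hμ α _ hα
        ((extend_rng hβ).trans hr) he)
    refine ⟨t.erase μ ∪ (Λ.caretFinset μ.src i).image (extend μ), ?_, ?_, ?_⟩
    · rw [Finset.coe_union, Λ.coe_image_extend, Finset.coe_erase]
    · intro p hp q hq α β hα hβ he
      rcases Finset.mem_union.1 hp with hp | hp <;> rcases Finset.mem_union.1 hq with hq | hq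
      · exact hdisj p (Finset.mem_of_mem_erase hp) q (Finset.mem_of_mem_erase hq) α β hα hβ he
      · obtain ⟨ν, hν, rfl⟩ := Finset.mem_image.1 hq
        exact (hne p hp ν hν α β hα hβ he).elim
      · obtain ⟨ν, hν, rfl⟩ := Finset.mem_image.1 hp
        exact (hne q hq ν hν β α hβ hα he.symm).elim
      · obtain ⟨ν, hν, rfl⟩ := Finset.mem_image.1 hp
        obtain ⟨ν', hν', rfl⟩ := Finset.mem_image.1 hq
        rw [mem_caretFinset] at hν hν'
        -- Leaves grafted at the same `μ` have equal degree, so unique factorisation separates them.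
        refine (Λ.extend_inj hα hβ ?_ he).1
        rw [Λ.d_extend (Λ.rng_of_mem_caret hν), Λ.d_extend (Λ.rng_of_mem_caret hν'),
          Λ.d_eq_of_mem_caret hν hν']
    · rw [Finset.sum_union, Finset.sum_image (Λ.extend_injOn μ i), ← hsum,
        ← Finset.sum_erase_add t _ hμ]
      · congr 1
        rw [← M.op_vtx_src μ ξ, ← M.sum_caret_norm_sq _ i]
        refine Finset.sum_congr rfl fun ν hν => ?_
        rw [M.op_extend (Λ.rng_of_mem_caret (Λ.mem_caretFinset.1 hν))]
      · rw [Finset.disjoint_left]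
        intro p hp hq
        obtain ⟨ν, hν, rfl⟩ := Finset.mem_image.1 hq
        exact hne _ hp ν hν (Λ.vtx _) (Λ.vtx _) rfl rfl rfl

theorem sum_norm_sq_of_isTree {v : V} {t : Finset (GPath V)}
    (ht : Λ.IsTree v (t : Set (GPath V))) (ξ : H) :
    ∑ μ ∈ t, ‖M.op μ ξ‖ ^ 2 = ‖M.op (Λ.vtx v) ξ‖ ^ 2 := by
  obtain ⟨t', h, -, hs⟩ := M.exists_finset_of_isTree ht ξ
  rw [← Finset.coe_injective h, hs]

theorem IsComplete.isWeaklyComplete {H' : Submodule ℂ H} (h : M.IsComplete H') :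
    M.IsWeaklyComplete H' := by
  intro K hK hKH'
  rw [Submodule.eq_bot_iff]
  by_contra! hne
  obtain ⟨ζ, hζ, hζ0⟩ := hne
  obtain ⟨v, hv⟩ := M.exists_op_vtx_ne_zero hζ0
  set ξ := M.op (Λ.vtx v) ζ with hξ
  have hξK : ξ ∈ K := hK.op_mem M _ hζ
  -- With `ε = ‖ξ‖` the bound fails: by orthogonality each term is at least `‖A_μ ξ‖²`, and these
  -- sum to `‖ξ‖²`.
  obtain ⟨t, ht, η, hη, hlt⟩ := h ‖ξ‖ (norm_pos_iff.2 hv) v ξ ⟨ζ, rfl⟩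
  have hs := M.sum_norm_sq_of_isTree ht ξ
  rw [hξ, M.op_vtx_op_vtx, ← hξ] at hs
  rw [← hs] at hlt
  refine hlt.not_ge (Finset.sum_le_sum fun μ hμ => ?_)
  have horth : ⟪M.op μ ξ, η μ⟫_ℂ = 0 :=
    Submodule.inner_left_of_mem_orthogonal (hη μ hμ) (hKH' (hK.op_mem M μ hξK))
  have := norm_sub_sq (𝕜 := ℂ) (M.op μ ξ) (η μ)
  rw [horth] at this
  simp only [map_zero, mul_zero, sub_zero] at this
  rw [this]
  nlinarith [sq_nonneg ‖η μ‖]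

/-- A vector all of whose images `A_λ ξ` are orthogonal to a weakly complete submodule is
zero. -/
theorem IsWeaklyComplete.eq_zero {H' : Submodule ℂ H} (h : M.IsWeaklyComplete H') {ξ : H}
    (hξ : ∀ p, M.op p ξ ∈ H'ᗮ) : ξ = 0 := by
  -- `K` is invariant because `A_q A_p` is either the operator of a concatenated path or zero.
  let K : Submodule ℂ H := ⨅ p, H'ᗮ.comap (M.op p : H →ₗ[ℂ] H)
  have hmem : ∀ ζ, ζ ∈ K ↔ ∀ p, M.op p ζ ∈ H'ᗮ := fun ζ => by
    simp [K, Submodule.mem_iInf]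
  have hclosed : IsClosed (K : Set H) := by
    have : (K : Set H) = ⋂ p, M.op p ⁻¹' (H'ᗮ : Set H) := by
      ext ζ
      simp only [SetLike.mem_coe, hmem, Set.mem_iInter, Set.mem_preimage]
    rw [this]
    exact isClosed_iInter fun p => (Submodule.isClosed_orthogonal H').preimage (M.op p).continuous
  have hsub : M.IsSubmodule K := by
    refine M.isSubmodule_of_op_mem hclosed fun p ζ hζ => (hmem _).2 fun q => ?_
    by_cases hqp : q.rng = p.src
    · rw [← M.op_extend hqp]
      exact (hmem _).1 hζ _
    · rw [M.op_op_of_ne hqp]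
      exact Submodule.zero_mem _
  -- The condition defining `K` controls only the components `A_v ζ`; nondegeneracy recovers `ζ`
  -- from them weakly.
  have hle : K ≤ H'ᗮ := by
    intro ζ hζ
    rw [Submodule.mem_orthogonal]
    intro η hη
    have h1 := M.nondegenerate η ζ
    have h2 : (fun v : V => ⟪η, M.π (aGen Λ (Λ.vtx v)) ζ⟫_ℂ) = fun _ => 0 := by
      funext v
      exact Submodule.inner_right_of_mem_orthogonal hη ((hmem _).1 hζ (Λ.vtx v))
    rw [h2] at h1
    exact h1.unique hasSum_zero
  have := h K hsub hle
  exact (Submodule.eq_bot_iff K).1 this ξ ((hmem ξ).2 hξ)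

/-! ### Transfer of functions along carets -/

/-- The transfer operator of colour `i` on families of functions on `H` indexed by vertices. -/
noncomputable def transfer (i : Fin k) (F : V → H → ℝ) (v : V) (ξ : H) : ℝ :=
  ∑ ν ∈ Λ.caretFinset v i, F ν.src (M.op ν ξ)

theorem transfer_mono (i : Fin k) : Monotone (M.transfer i) := fun _ _ h _ _ =>
  Finset.sum_le_sum fun _ _ => h _ _

/-- Commutation is what makes the fold over a multiset of colours in `defect` well defined. -/
theorem transfer_comm [Λ.LocallyConvex] (i j : Fin k) (F : V → H → ℝ) :
    M.transfer i (M.transfer j F) = M.transfer j (M.transfer i F) := by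
  have key : ∀ a b v ξ, M.transfer a (M.transfer b F) v ξ =
      ∑ μ ∈ Λ.caretFinset v a, ∑ ν ∈ Λ.caretFinset μ.src b,
        F (extend μ ν).src (M.op (extend μ ν) ξ) := by
    intro a b v ξ
    refine Finset.sum_congr rfl fun μ _ => Finset.sum_congr rfl fun ν hν => ?_
    rw [M.op_extend (Λ.rng_of_mem_caret (Λ.mem_caretFinset.1 hν)), extend_src]
  funext v ξ
  rw [key, key]
  exact Λ.sum_caret_comm v i j fun p => F p.src (M.op p ξ)

instance [Λ.LocallyConvex] : LeftCommutative M.transfer := ⟨M.transfer_comm⟩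

open Classical in
/-- The transfer of colour `i` dominates the effect of grafting carets of colour `i` to all
elements of `r` in a tree `r ∪ s`. -/
theorem exists_isTree_sum_le_of_union {F : V → H → ℝ} (hF : ∀ v ξ, 0 ≤ F v ξ) (i : Fin k)
    {v : V} (ξ : H) (r : Finset (GPath V)) : ∀ s : Finset (GPath V),
    Λ.IsTree v ((r ∪ s : Finset (GPath V)) : Set (GPath V)) →
    ∃ t : Finset (GPath V), Λ.IsTree v (t : Set (GPath V)) ∧
      ∑ μ ∈ t, F μ.src (M.op μ ξ) ≤
        ∑ μ ∈ r, M.transfer i F μ.src (M.op μ ξ) + ∑ μ ∈ s, F μ.src (M.op μ ξ) := by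
  induction r using Finset.induction_on with
  | empty => intro s hs; exact ⟨s, by simpa using hs, by simp⟩
  | insert μ r hμ ih =>
    -- `r` holds the leaves still to be grafted, and `s` accumulates those already dealt with.
    intro s hs
    have hgraft := IsTree.graft _ μ i hs (by simp)
    rw [← Λ.coe_image_extend, ← Finset.coe_erase, ← Finset.coe_union] at hgraft
    have hset : (insert μ r ∪ s).erase μ ∪ (Λ.caretFinset μ.src i).image (extend μ) =
        r ∪ (s.erase μ ∪ (Λ.caretFinset μ.src i).image (extend μ)) := by
      rw [← Finset.union_assoc, Finset.erase_union_distrib, Finset.erase_insert hμ]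
    rw [hset] at hgraft
    obtain ⟨t, ht, hle⟩ := ih _ hgraft
    refine ⟨t, ht, hle.trans ?_⟩
    have h1 : ∑ p ∈ (Λ.caretFinset μ.src i).image (extend μ), F p.src (M.op p ξ) =
        M.transfer i F μ.src (M.op μ ξ) := by
      rw [Finset.sum_image (Λ.extend_injOn μ i)]
      refine Finset.sum_congr rfl fun ν hν => ?_
      rw [M.op_extend (Λ.rng_of_mem_caret (Λ.mem_caretFinset.1 hν)), extend_src]
    -- Overlaps in the union only decrease the sum, since `F` is nonnegative; no disjointness is
    -- needed.
    have h2 : ∑ p ∈ s.erase μ ∪ (Λ.caretFinset μ.src i).image (extend μ), F p.src (M.op p ξ) ≤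
        ∑ p ∈ s, F p.src (M.op p ξ) + M.transfer i F μ.src (M.op μ ξ) := by
      rw [← h1, ← Finset.sum_union_inter]
      refine le_add_of_le_of_nonneg ?_ (Finset.sum_nonneg fun _ _ => hF _ _)
      exact Finset.sum_le_sum_of_subset_of_nonneg
        (Finset.union_subset_union_left (Finset.erase_subset _ _)) fun _ _ _ => hF _ _
    rw [Finset.sum_insert hμ]
    linarith

/-! ### The defect of a submodule -/

variable {H' : Submodule ℂ H} [H'.HasOrthogonalProjection]

/-- `ξ - Pξ` lies in `H'`, so by invariance `A_p` keeps it there and `P` kills its image. -/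
theorem starProjection_op (hH' : M.IsSubmodule H') (p : GPath V)
    (ξ : H) :
    H'ᗮ.starProjection (M.op p (H'ᗮ.starProjection ξ)) = H'ᗮ.starProjection (M.op p ξ) := by
  have h1 : ξ - H'ᗮ.starProjection ξ ∈ H' := by
    have := H'ᗮ.sub_starProjection_mem_orthogonal ξ
    rwa [Submodule.orthogonal_orthogonal] at this
  have h2 := Submodule.starProjection_orthogonal_apply_eq_zero (hH'.op_mem M p h1)
  rw [map_sub, map_sub, sub_eq_zero] at h2
  exact h2.symm

variable (H')

/-- The iterated transfers of the squared distance to `H'`, indexed by the multiset of the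
colours that were used. -/
noncomputable def defect [Λ.LocallyConvex] (s : Multiset (Fin k)) : V → H → ℝ :=
  s.foldr M.transfer fun v ξ => ‖H'ᗮ.starProjection (M.op (Λ.vtx v) ξ)‖ ^ 2

variable [Λ.LocallyConvex]

theorem defect_zero (v : V) (ξ : H) :
    M.defect H' 0 v ξ = ‖H'ᗮ.starProjection (M.op (Λ.vtx v) ξ)‖ ^ 2 := rfl

theorem defect_cons (i : Fin k) (s : Multiset (Fin k)) :
    M.defect H' (i ::ₘ s) = M.transfer i (M.defect H' s) :=
  Multiset.foldr_cons _ _ _ _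

theorem defect_cons_apply (i : Fin k) (s : Multiset (Fin k)) (v : V) (ξ : H) :
    M.defect H' (i ::ₘ s) v ξ = ∑ ν ∈ Λ.caretFinset v i, M.defect H' s ν.src (M.op ν ξ) := by
  rw [defect_cons]; rfl

theorem defect_nonneg (s : Multiset (Fin k)) : ∀ v ξ, 0 ≤ M.defect H' s v ξ := by
  induction s using Multiset.induction_on with
  | empty => intro v ξ; exact sq_nonneg _
  | cons i s ih =>
    intro v ξ
    rw [defect_cons_apply]
    exact Finset.sum_nonneg fun _ _ => ih _ _

theorem continuous_defect (s : Multiset (Fin k)) : ∀ v, Continuous (M.defect H' s v) := by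
  induction s using Multiset.induction_on with
  | empty =>
    intro v
    change Continuous fun ξ => ‖H'ᗮ.starProjection (M.op (Λ.vtx v) ξ)‖ ^ 2
    fun_prop
  | cons i s ih =>
    intro v
    simp only [funext (M.defect_cons_apply H' i s v)]
    exact continuous_finsetSum _ fun ν _ => (ih _).comp (M.op ν).continuous

theorem defect_smul (c : ℂ) (s : Multiset (Fin k)) :
    ∀ v ξ, M.defect H' s v (c • ξ) = ‖c‖ ^ 2 * M.defect H' s v ξ := by
  induction s using Multiset.induction_on with
  | empty => intro v ξ; simp only [defect_zero, map_smul, norm_smul, mul_pow]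
  | cons i s ih =>
    intro v ξ
    simp only [defect_cons_apply, map_smul, ih, Finset.mul_sum]

theorem defect_op_vtx (s : Multiset (Fin k)) (v : V) (ξ : H) :
    M.defect H' s v (M.op (Λ.vtx v) ξ) = M.defect H' s v ξ := by
  induction s using Multiset.induction_on with
  | empty => rw [defect_zero, defect_zero, op_vtx_op_vtx]
  | cons i s ih =>
    rw [defect_cons_apply, defect_cons_apply]
    refine Finset.sum_congr rfl fun ν hν => ?_
    rw [← Λ.rng_of_mem_caret (Λ.mem_caretFinset.1 hν), M.op_vtx_rng]

variable {H'}

theorem defect_starProjection (hH' : M.IsSubmodule H') (s : Multiset (Fin k)) :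
    ∀ v ξ, M.defect H' s v (H'ᗮ.starProjection ξ) = M.defect H' s v ξ := by
  induction s using Multiset.induction_on with
  | empty => intro v ξ; rw [defect_zero, defect_zero, M.starProjection_op hH']
  | cons i s ih =>
    intro v ξ
    rw [defect_cons_apply, defect_cons_apply]
    refine Finset.sum_congr rfl fun ν _ => ?_
    rw [← ih, M.starProjection_op hH', ih]

/-- For the empty multiset, `P A_ν = P A_ν P` moves the projection before the caret, which then
preserves squared norms. The general case follows because the `T_j` are monotone and commute with
`T_i`. -/
theorem defect_cons_le (hH' : M.IsSubmodule H') (i : Fin k) (s : Multiset (Fin k)) :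
    M.defect H' (i ::ₘ s) ≤ M.defect H' s := by
  induction s using Multiset.induction_on with
  | empty =>
    intro v ξ
    rw [defect_cons_apply]
    calc ∑ ν ∈ Λ.caretFinset v i, M.defect H' 0 ν.src (M.op ν ξ)
        ≤ ∑ ν ∈ Λ.caretFinset v i,
            ‖M.op ν (H'ᗮ.starProjection (M.op (Λ.vtx v) ξ))‖ ^ 2 := by
          refine Finset.sum_le_sum fun ν hν => ?_
          have hr := Λ.rng_of_mem_caret (Λ.mem_caretFinset.1 hν)
          rw [defect_zero, op_vtx_src, ← M.op_vtx_rng ν ξ, hr, ← M.starProjection_op hH']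
          gcongr
          exact Submodule.norm_starProjection_apply_le _ _
      _ = ‖M.op (Λ.vtx v) (H'ᗮ.starProjection (M.op (Λ.vtx v) ξ))‖ ^ 2 :=
          M.sum_caret_norm_sq v i _
      _ ≤ ‖H'ᗮ.starProjection (M.op (Λ.vtx v) ξ)‖ ^ 2 := by
          gcongr
          exact M.norm_op_vtx_le v _
  | cons j s ih =>
    rw [Multiset.cons_swap, defect_cons, defect_cons M H' j s]
    exact M.transfer_mono j ih

theorem defect_antitone (hH' : M.IsSubmodule H') : Antitone (M.defect H') := by
  intro s t hst
  obtain ⟨r, rfl⟩ := Multiset.le_iff_exists_add.1 hst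
  clear hst
  induction r using Multiset.induction_on with
  | empty => simp
  | cons i r ih => rw [Multiset.add_cons]; exact (M.defect_cons_le hH' i _).trans ih

/-- The iterated transfers dominate the squared distances to `H'` along suitable trees. -/
theorem exists_isTree_sum_le_defect {v : V} (ξ : H) (s : Multiset (Fin k)) :
    ∀ t : Finset (GPath V), Λ.IsTree v (t : Set (GPath V)) →
    ∃ t' : Finset (GPath V), Λ.IsTree v (t' : Set (GPath V)) ∧
      ∑ μ ∈ t', ‖H'ᗮ.starProjection (M.op μ ξ)‖ ^ 2 ≤
        ∑ μ ∈ t, M.defect H' s μ.src (M.op μ ξ) := by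
  induction s using Multiset.induction_on with
  | empty =>
    intro t ht
    refine ⟨t, ht, le_of_eq (Finset.sum_congr rfl fun μ _ => ?_)⟩
    rw [defect_zero, op_vtx_src]
  | cons i s ih =>
    intro t ht
    classical
    obtain ⟨t₁, ht₁, hle₁⟩ := M.exists_isTree_sum_le_of_union (M.defect_nonneg H' s) i ξ t ∅
      (by simpa using ht)
    obtain ⟨t₂, ht₂, hle₂⟩ := ih t₁ ht₁
    refine ⟨t₂, ht₂, hle₂.trans (hle₁.trans ?_)⟩
    rw [defect_cons]
    simp

/-! ### The limit of the defects -/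

variable (H') in
/-- The infimum of the iterated transfers of the squared distance to `H'`. -/
noncomputable def limitDefect (v : V) (ξ : H) : ℝ := ⨅ s, M.defect H' s v ξ

theorem bddBelow_defect (v : V) (ξ : H) : BddBelow (Set.range fun s => M.defect H' s v ξ) :=
  ⟨0, by rintro _ ⟨s, rfl⟩; exact M.defect_nonneg H' s v ξ⟩

theorem limitDefect_le (s : Multiset (Fin k)) (v : V) (ξ : H) :
    M.limitDefect H' v ξ ≤ M.defect H' s v ξ :=
  ciInf_le (M.bddBelow_defect v ξ) s

/-- Multisets are directed under inclusion, so the decreasing family converges as a net. Limits,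
unlike bare infima, pass through the finite sums over carets. -/
theorem tendsto_defect (hH' : M.IsSubmodule H') (v : V) (ξ : H) :
    Filter.Tendsto (fun s => M.defect H' s v ξ) Filter.atTop (nhds (M.limitDefect H' v ξ)) :=
  tendsto_atTop_ciInf (fun _ _ h => M.defect_antitone hH' h v ξ) (M.bddBelow_defect v ξ)

/-- The transfer of a defect is again a defect, hence bounds the limit from above; then let the
multiset grow. -/
theorem limitDefect_le_sum (hH' : M.IsSubmodule H') (i : Fin k) (v : V) (ξ : H) :
    M.limitDefect H' v ξ ≤ ∑ ν ∈ Λ.caretFinset v i, M.limitDefect H' ν.src (M.op ν ξ) := by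
  refine ge_of_tendsto' (tendsto_finsetSum _ fun ν _ => M.tendsto_defect hH' ν.src (M.op ν ξ))
    fun s => ?_
  rw [← defect_cons_apply]
  exact M.limitDefect_le _ v ξ

/-- An infimum of continuous functions need not be continuous, but upper semicontinuity suffices to
attain a maximum on a compact sphere. -/
theorem upperSemicontinuous_limitDefect (v : V) :
    UpperSemicontinuous (M.limitDefect H' v) :=
  upperSemicontinuous_ciInf (fun ξ => M.bddBelow_defect v ξ) fun s =>
    (M.continuous_defect H' s v).upperSemicontinuous

theorem limitDefect_smul (c : ℂ) (v : V) (ξ : H) :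
    M.limitDefect H' v (c • ξ) = ‖c‖ ^ 2 * M.limitDefect H' v ξ := by
  unfold limitDefect
  rw [Real.mul_iInf_of_nonneg (sq_nonneg _)]
  exact iInf_congr fun s => M.defect_smul H' c s v ξ

theorem limitDefect_op_vtx (v : V) (ξ : H) :
    M.limitDefect H' v (M.op (Λ.vtx v) ξ) = M.limitDefect H' v ξ :=
  iInf_congr fun s => M.defect_op_vtx H' s v ξ

theorem limitDefect_starProjection (hH' : M.IsSubmodule H') (v : V) (ξ : H) :
    M.limitDefect H' v (H'ᗮ.starProjection ξ) = M.limitDefect H' v ξ :=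
  iInf_congr fun s => M.defect_starProjection hH' s v ξ

/-- If completeness fails for some `ε`, `v` and `ξ`, every tree has error at least `ε²`. Every
defect dominates the error of some tree, so `ε²` bounds the limit from below. -/
theorem exists_limitDefect_pos (h : ¬ M.IsComplete H') : ∃ v ξ, 0 < M.limitDefect H' v ξ := by
  unfold IsComplete at h
  push Not at h
  obtain ⟨ε, hε, v, ξ, ⟨ζ, rfl⟩, h⟩ := h
  refine ⟨v, M.op (Λ.vtx v) ζ, (pow_pos hε 2).trans_le (le_ciInf fun s => ?_)⟩
  obtain ⟨t, ht, hle⟩ := M.exists_isTree_sum_le_defect (H' := H') (M.op (Λ.vtx v) ζ) s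
    {Λ.vtx v} (by simpa using IsTree.trivial)
  rw [Finset.sum_singleton, op_vtx_op_vtx] at hle
  refine le_trans ?_ hle
  -- The candidates `η_μ` are the best approximations in `H'`; their residues are `P A_μ ξ`.
  refine (h t ht (fun μ => H'.starProjection (M.op μ (M.op (Λ.vtx v) ζ)))
    fun μ _ => Submodule.starProjection_apply_mem _ _).trans (le_of_eq ?_)
  refine Finset.sum_congr rfl fun μ _ => ?_
  rw [Submodule.starProjection_orthogonal_val]
  rfl

/-- The largest value of the limit defect on unit vectors is attained. -/
theorem exists_isMax_limitDefect [FiniteDimensional ℂ H]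
    (hpos : ∃ v ξ, 0 < M.limitDefect H' v ξ) :
    ∃ c : ℝ, 0 < c ∧ (∀ v ξ, M.limitDefect H' v ξ ≤ c * ‖ξ‖ ^ 2) ∧
      ∃ v ξ, ‖ξ‖ = 1 ∧ M.limitDefect H' v ξ = c := by
  obtain ⟨v₀, ξ₀, h₀⟩ := hpos
  have hzero : ∀ v, M.limitDefect H' v 0 = 0 := fun v => by
    simpa using M.limitDefect_smul (H' := H') 0 v 0
  have hvan : ∀ v, M.op (Λ.vtx v) = 0 → ∀ ξ, M.limitDefect H' v ξ = 0 := fun v hv ξ => by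
    rw [← M.limitDefect_op_vtx, hv, zero_apply, hzero]
  have hξ₀ : ξ₀ ≠ 0 := by
    rintro rfl
    exact h₀.ne' (hzero v₀)
  have : Nontrivial H := ⟨ξ₀, 0, hξ₀⟩
  have hmax : ∀ v, ∃ ξ : H, ‖ξ‖ = 1 ∧
      ∀ η : H, ‖η‖ = 1 → M.limitDefect H' v η ≤ M.limitDefect H' v ξ := by
    intro v
    have : ProperSpace H := FiniteDimensional.proper ℂ H
    obtain ⟨ξ, hξ, hm⟩ := UpperSemicontinuousOn.exists_isMaxOn
      (Set.nonempty_coe_sort.1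
        (NormedSpace.sphere_nonempty_rclike ℂ (E := H) (r := 1) zero_le_one))
      (isCompact_sphere (0 : H) 1)
      ((M.upperSemicontinuous_limitDefect (H' := H') v).upperSemicontinuousOn _)
    exact ⟨ξ, by simpa using hξ, fun η hη => hm (by simpa using hη)⟩
  choose e he hm using hmax
  have hscale : ∀ v ξ, M.limitDefect H' v ξ ≤ M.limitDefect H' v (e v) * ‖ξ‖ ^ 2 := by
    intro v ξ
    rcases eq_or_ne ξ 0 with rfl | hξ
    · simp [hzero]
    have hn : ‖ξ‖ ≠ 0 := norm_ne_zero_iff.2 hξ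
    have h1 := hm v ((‖ξ‖⁻¹ : ℂ) • ξ) (by simp [norm_smul, hn])
    have h2 : ξ = (‖ξ‖ : ℂ) • ((‖ξ‖⁻¹ : ℂ) • ξ) := by
      rw [smul_smul, mul_inv_cancel₀ (by exact_mod_cast hn), one_smul]
    conv_lhs => rw [h2, limitDefect_smul]
    rw [mul_comm]
    simp only [Complex.norm_real, norm_norm]
    gcongr
  have hv₀ : v₀ ∈ M.finite_setOf_op_vtx_ne_zero.toFinset := by
    simp only [Set.Finite.mem_toFinset]
    exact fun hv => h₀.ne' (hvan v₀ hv ξ₀)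
  -- The limit defect vanishes at vertices with `A_v = 0`, so a maximum over the finitely many
  -- others is global.
  obtain ⟨w, -, hw⟩ := Finset.exists_max_image _ (fun v => M.limitDefect H' v (e v)) ⟨v₀, hv₀⟩
  have hc : 0 < M.limitDefect H' w (e w) := by
    have h1 := h₀.trans_le (hscale v₀ ξ₀)
    exact (pos_of_mul_pos_left h1 (sq_nonneg _)).trans_le (hw v₀ hv₀)
  refine ⟨_, hc, fun v ξ => ?_, w, e w, he w, rfl⟩
  by_cases hv : M.op (Λ.vtx v) = 0
  · rw [hvan v hv]; positivity
  · refine (hscale v ξ).trans ?_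
    gcongr
    exact hw v (by simpa using hv)

/-- A maximiser of the limit defect is mapped to maximisers by all `A_λ`. -/
theorem limitDefect_op_eq (hH' : M.IsSubmodule H') {c : ℝ}
    (hle : ∀ v ξ, M.limitDefect H' v ξ ≤ c * ‖ξ‖ ^ 2) (hc : 0 ≤ c) (n : ℕ) :
    ∀ (p : GPath V) (ξ : H), ∑ i, Λ.d p i = n → M.limitDefect H' p.rng ξ = c * ‖ξ‖ ^ 2 →
      M.limitDefect H' p.src (M.op p ξ) = c * ‖M.op p ξ‖ ^ 2 := by
  induction n with
  | zero =>
    intro p ξ hd hξ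
    have h0 : Λ.d p = 0 := by
      funext i
      simpa using (Finset.sum_eq_zero_iff.1 hd) i (Finset.mem_univ i)
    rw [Λ.eq_vtx_of_d_eq_zero h0]
    refine le_antisymm (hle _ _) ?_
    change _ ≤ M.limitDefect H' p.rng (M.op (Λ.vtx p.rng) ξ)
    rw [limitDefect_op_vtx, hξ]
    gcongr
    exact M.norm_op_vtx_le _ _
  | succ n ih =>
    intro p ξ hd hξ
    obtain ⟨i, hi⟩ : ∃ i, Λ.d p i ≠ 0 := by
      by_contra! h
      simp [h] at hd
    have hsplit : Λ.d p = Pi.single i 1 + (Λ.d p - Pi.single i 1) := by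
      funext j
      by_cases hj : j = i
      · subst hj; simp; omega
      · simp [hj]
    -- Peel off the edge at the range end, whose operator acts first: `A_{μν} = A_ν A_μ`.
    obtain ⟨μ, ν, hνμ, hμ, hν, rfl⟩ := Λ.exists_extend_eq p hsplit
    have hsum : ∑ j, Λ.d ν j = n := by
      rw [Λ.d_extend hνμ, hμ] at hd
      simp only [Pi.add_apply, Finset.sum_add_distrib,
        Finset.mem_univ, if_true, Pi.single_apply, Finset.sum_ite_eq'] at hd
      omega
    rw [extend_rng hνμ] at hξ
    rw [extend_src, M.op_extend hνμ]
    refine ih ν _ hsum ?_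
    rw [hνμ]
    have hmem : μ ∈ Λ.caretFinset μ.rng i := by
      rw [mem_caretFinset]; exact Or.inl ⟨rfl, hμ⟩
    -- The caret sums are squeezed between equal bounds, so the termwise inequalities are all
    -- equalities.
    refine (Finset.sum_eq_sum_iff_of_le fun κ _ => hle κ.src (M.op κ ξ)).1 ?_ μ hmem
    refine le_antisymm (Finset.sum_le_sum fun κ _ => hle κ.src (M.op κ ξ)) ?_
    refine le_trans ?_ (M.limitDefect_le_sum hH' i μ.rng ξ)
    rw [hξ, ← Finset.mul_sum, M.sum_caret_norm_sq]
    gcongr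
    exact M.norm_op_vtx_le _ _

/-- The limit defect does not see the component in `H'`, so a maximiser cannot afford to have one:
`c‖ξ‖² = F(v, Pξ) ≤ c‖Pξ‖²`. -/
theorem mem_orthogonal_of_limitDefect_eq (hH' : M.IsSubmodule H') {c : ℝ} (hc : 0 < c)
    (hle : ∀ v ξ, M.limitDefect H' v ξ ≤ c * ‖ξ‖ ^ 2) {v : V} {ξ : H}
    (hξ : M.limitDefect H' v ξ = c * ‖ξ‖ ^ 2) : ξ ∈ H'ᗮ := by
  rw [Submodule.mem_iff_norm_starProjection]
  refine le_antisymm (Submodule.norm_starProjection_apply_le _ _) ?_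
  have h1 := hle v (H'ᗮ.starProjection ξ)
  rw [M.limitDefect_starProjection hH', hξ] at h1
  exact le_of_sq_le_sq (le_of_mul_le_mul_left h1 hc) (norm_nonneg _)

/-! ### Weakly complete submodules are complete -/

theorem IsWeaklyComplete.isComplete [FiniteDimensional ℂ H] (hH' : M.IsSubmodule H')
    (h : M.IsWeaklyComplete H') : M.IsComplete H' := by
  by_contra hcomp
  obtain ⟨c, hc, hle, v, ξ, hξ1, hξc⟩ := M.exists_isMax_limitDefect (M.exists_limitDefect_pos hcomp)
  have hξ : M.limitDefect H' v ξ = c * ‖ξ‖ ^ 2 := by rw [hξc, hξ1]; ring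
  -- Passing from `ξ` to `A_v ξ` kills the images under paths whose range is not `v`, over which
  -- maximality of `ξ` at `v` gives no control. The limit defect is unchanged, so `c ≤ 0` results.
  have hζ : M.op (Λ.vtx v) ξ = 0 := by
    refine h.eq_zero M fun p => ?_
    by_cases hp : p.rng = v
    · subst hp
      rw [M.op_vtx_rng]
      exact M.mem_orthogonal_of_limitDefect_eq hH' hc hle
        (M.limitDefect_op_eq hH' hle hc.le _ p ξ rfl hξ)
    · rw [M.op_op_of_ne hp]
      exact Submodule.zero_mem _
  have h1 := M.limitDefect_op_vtx (H' := H') v ξ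
  have h2 := hle v (M.op (Λ.vtx v) ξ)
  rw [h1, hξc, hζ] at h2
  simp only [norm_zero] at h2
  linarith

end KGraph.AModule

theorem mainTheorem8 {k : ℕ} {V : Type*} [Category V]
    (Λ : KGraph k V) [Λ.RowFinite] [Λ.LocallyConvex]
    (H : Type*) [NormedAddCommGroup H] [InnerProductSpace ℂ H] [CompleteSpace H]
    [FiniteDimensional ℂ H] (M : Λ.AModule H)
    (H' : Submodule ℂ H) (hH' : M.IsSubmodule H') :
    M.IsWeaklyComplete H' ↔ M.IsComplete H' :=
  ⟨fun h => h.isComplete M hH', fun h => h.isWeaklyComplete M⟩
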